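/- Let $E$ be a Euclidean space, $Y\subset E$ a nonempty convex compact set, $\|\cdot\|$ a norm on $E$ with conjugate norm $\|\xi\|_*=\max_{\|x\|\le1}\langle\xi,x\rangle$. Let $\omega:Y\to\mathbb R$ be continuous and convex, put $\partial\omega(y)=\{\xi\in E:\omega(z)\ge\omega(y)+\langle\xi,z-y\rangle\ \forall z\in Y\}$ and $Y^o=\{y\in Y:\partial\omega(y)\ne\emptyset\}$, and let $\omega':Y^o\to E$ be a continuous selection of $\partial\omega$ with $\langle\omega'(y)-\omega'(y'),y-y'\rangle\ge\|y-y'\|^2$ for all $y,y'\in Y^o$. Set $y_\omega=\operatorname{argmin}_Y\omega$ and $\Omega=\sqrt{2[\max_Y\omega-\min_Y\omega]}$. Let $g:Y\to E$ be a vector field with $\|g(y)\|_*\le L[g]<\infty$ for all $y\in Y$, and let $\gamma\in(0,1)$ and $\epsilon>0$. The Mirror Descent Level (MDL) method starts with $y_1=y_\omega$, $I_0=\emptyset$, $\Delta_0=+\infty$, no phase having been started. At step $t=1,2,\dots$, with $s-1$ the number of phases started so far, it puts $h_t(z)=\langle g(y_t),y_t-z\rangle$, $I_t^+=I_{t-1}\cup\{t\}$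 and solves $$\epsilon_t=\max_{y\in Y}\min_{\tau\in I_t^+}h_\tau(y),$$ obtaining $\epsilon_t$ and (any) weights $\lambda^t_\tau\ge0$, $1\le\tau\le t$, with $\lambda^t_\tau=0$ for $\tau\notin I_t^+$, $\sum_{\tau}\lambda^t_\tau=1$ and $\epsilon_t=\max_{y\in Y}\sum_{\tau}\lambda^t_\tau h_\tau(y)$. If $\epsilon_t\le\epsilon$, it terminates with output $y^t=\{y_\tau,g(y_\tau)\}_{\tau=1}^t$, $\lambda^t=\{\lambda^t_\tau\}_{\tau=1}^t$. Otherwise, if $\epsilon_t\le\gamma\Delta_{s-1}$, step $t$ starts phase $s$: $\Delta_s=\epsilon_t$, $I_t=\{\tau\le t:\lambda^t_\tau>0\}\cup\{1\}$, $\widehat y_t=y_\omega$; if $\epsilon_t>\gamma\Delta_{s-1}$, then $I_t=I_t^+$, $\widehat y_t=y_t$. In both cases $$U_t=\{y\in Y:h_\tau(y)\ge\gamma\epsilon_t\ \forall\tau\in I_t\},\qquad y_{t+1}=\operatorname*{argmin}_{y\in U_t}\left[\omega(y)-\langle\omega'(\widehat y_t),y\rangle\right],$$ and the method passes to step $t+1$.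 Then the method is well defined (the point $y_\omega$ exists and is unique; at every step that is reached $\epsilon_t$ and weights $\lambda^t$ as above exist; and if the method does not terminate at the step, $\widehat y_t\in Y^o$ and $y_{t+1}$ exists and is unique), and, whatever weights $\lambda^t$ are chosen, it terminates after finitely many steps. Its output satisfies $y_\tau\in Y$, $\lambda^t_\tau\ge0$, $\sum_{\tau=1}^t\lambda^t_\tau=1$ and $$\epsilon(y^t,\lambda^t):=\max_{y\in Y}\sum_{\tau=1}^t\lambda^t_\tau\langle g(y_\tau),y_\tau-y\rangle\le\epsilon,$$ and the number of steps (the terminal one included) does not exceed $$N=\frac{2\Omega^2L^2[g]}{\gamma^4(1-\gamma^2)\epsilon^2}+1.$$ -/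

import Mathlib

/-! Mirror Descent Level method: proximal setups, certificates, and the method itself
as a transition system on states. -/

namespace MDL

noncomputable section

variable {E : Type*} [NormedAddCommGroup E] [InnerProductSpace ℝ E]

/-- The norm conjugate to `ν`: `‖ξ‖_* = sup {⟨ξ, x⟩ : ν x ≤ 1}`. -/
def dualNorm (ν : Seminorm ℝ E) (ξ : E) : ℝ :=
  sSup ((fun x => inner ℝ ξ x) '' {x : E | ν x ≤ 1})

/-- The subdifferential at `y` of a function `ω` with domain `Y`. -/
def subdiff (Y : Set E) (ω : E → ℝ) (y : E) : Set E :=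
  {ξ | ∀ z ∈ Y, ω y + inner ℝ ξ (z - y) ≤ ω z}

/-- The set `Y^o` of points of `Y` at which `ω` has a nonempty subdifferential. -/
def subdiffDomain (Y : Set E) (ω : E → ℝ) : Set E :=
  {y ∈ Y | (subdiff Y ω y).Nonempty}

/-- `(ν, ω)` is a proximal setup for `Y`, with `ω'` the continuous selection of subgradients:
`ν` is a norm, and `ω` is continuous, convex, and strongly convex with modulus 1 w.r.t. `ν`. -/
structure IsProximalSetup (Y : Set E) (ν : Seminorm ℝ E) (ω : E → ℝ) (ω' : E → E) : Prop where
  norm_definite : ∀ x, ν x = 0 → x = 0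
  continuousOn : ContinuousOn ω Y
  convexOn : ConvexOn ℝ Y ω
  selection : ∀ y ∈ subdiffDomain Y ω, ω' y ∈ subdiff Y ω y
  selection_continuousOn : ContinuousOn ω' (subdiffDomain Y ω)
  strong : ∀ y ∈ subdiffDomain Y ω, ∀ y' ∈ subdiffDomain Y ω,
    ν (y - y') ^ 2 ≤ inner ℝ (ω' y - ω' y') (y - y')

/-- `x` is a minimizer of `f` over `S`. -/
def IsArgmin (S : Set E) (f : E → ℝ) (x : E) : Prop :=
  x ∈ S ∧ ∀ z ∈ S, f x ≤ f z

/-- The `ω`-diameter `Ω = √(2 [max_Y ω - min_Y ω])` of `Y`. -/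
def omegaDiam (Y : Set E) (ω : E → ℝ) : ℝ :=
  Real.sqrt (2 * (sSup (ω '' Y) - sInf (ω '' Y)))

/-- The affine function `h_y(z) = ⟨g(y), y - z⟩`. -/
def affineAt (g : E → E) (y z : E) : ℝ := inner ℝ (g y) (y - z)

/-- The values, as `z` ranges over `Y`, of `∑_{τ = 1}^t λ_τ ⟨g(y_τ), y_τ - z⟩`. -/
def certificateValues (Y : Set E) (g : E → E) (t : ℕ) (y : ℕ → E) (lam : ℕ → ℝ) : Set ℝ :=
  (fun z => ∑ τ ∈ Finset.Icc 1 t, lam τ * affineAt g (y τ) z) '' Y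

/-- The weights `λ_1, …, λ_t` form an accuracy certificate. -/
def IsCertificate (t : ℕ) (lam : ℕ → ℝ) : Prop :=
  (∀ τ ∈ Finset.Icc 1 t, 0 ≤ lam τ) ∧ ∑ τ ∈ Finset.Icc 1 t, lam τ = 1

/-- The resolution of the certificate `λ_1, …, λ_t` at the protocol `(y_τ, g(y_τ))_{τ = 1}^t`. -/
def resolution (Y : Set E) (g : E → E) (t : ℕ) (y : ℕ → E) (lam : ℕ → ℝ) : ℝ :=
  sSup (certificateValues Y g t y lam)

/-- What the method remembers when it enters step `t`. -/
structure State (E : Type*) where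
  /-- the number of the step that is entered -/
  t : ℕ
  /-- the search points `y_1, …, y_t`; other values are irrelevant -/
  y : ℕ → E
  /-- the index set `I_{t-1}` -/
  I : Finset ℕ
  /-- the optimality gap of the latest phase started before step `t` (`+∞` if there is none) -/
  gap : EReal

/-- The state in which step 1 is entered: `y_1 = y_ω`, `I_0 = ∅`, `Δ_0 = +∞`. -/
def initState (yω : E) : State E := ⟨1, fun _ => yω, ∅, ⊤⟩

/-- The index set `I_t^+ = I_{t-1} ∪ {t}`. -/
def State.Iplus (σ : State E) : Finset ℕ := insert σ.t σ.I

/-- `(e, lam)` is an outcome of solving the auxiliary problem of step `t`: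
`e = ε_t = max_{z ∈ Y} min_{τ ∈ I_t^+} h_τ(z)`, and `lam = λ^t` consists of nonnegative weights
supported on `I_t^+`, of sum 1, such that `ε_t = max_{z ∈ Y} ∑_{τ ∈ I_t^+} λ^t_τ h_τ(z)`. -/
structure SolvesAux (Y : Set E) (g : E → E) (σ : State E) (e : ℝ) (lam : ℕ → ℝ) : Prop where
  value : IsGreatest
    ((fun z => σ.Iplus.inf' (Finset.insert_nonempty _ _) (fun τ => affineAt g (σ.y τ) z)) '' Y) e
  nonneg : ∀ τ, 0 ≤ lam τ
  support : ∀ τ, τ ∉ σ.Iplus → lam τ = 0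
  sum_eq_one : ∑ τ ∈ σ.Iplus, lam τ = 1
  weights : IsGreatest ((fun z => ∑ τ ∈ σ.Iplus, lam τ * affineAt g (σ.y τ) z) '' Y) e

/-- Step `t` starts a new phase: `ε_t ≤ γ Δ` with `Δ` the gap of the latest phase. -/
def StartsPhase (γ : ℝ) (σ : State E) (e : ℝ) : Prop := (e : EReal) ≤ (γ : EReal) * σ.gap

open Classical in
/-- The index set `I_t`. -/
def newI (γ : ℝ) (σ : State E) (e : ℝ) (lam : ℕ → ℝ) : Finset ℕ :=
  if StartsPhase γ σ e then (Finset.Icc 1 σ.t).filter (fun τ => 0 < lam τ) ∪ {1} else σ.Iplus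

open Classical in
/-- The gap of the phase to which step `t` belongs. -/
def newGap (γ : ℝ) (σ : State E) (e : ℝ) : EReal :=
  if StartsPhase γ σ e then (e : EReal) else σ.gap

open Classical in
/-- The point `ŷ_t` that is projected at step `t`. -/
def proxCenter (γ : ℝ) (yω : E) (σ : State E) (e : ℝ) : E :=
  if StartsPhase γ σ e then yω else σ.y σ.t

/-- The level set `U_t = {z ∈ Y : h_τ(z) ≥ γ ε_t for all τ ∈ I_t}`. -/
def levelSet (Y : Set E) (g : E → E) (γ : ℝ) (σ : State E) (e : ℝ) (lam : ℕ → ℝ) : Set E :=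
  {z ∈ Y | ∀ τ ∈ newI γ σ e lam, γ * e ≤ affineAt g (σ.y τ) z}

/-- A nonterminal step: in state `σ` the auxiliary problem is solved with outcome `(e, lam)`,
`e = ε_t > ε`, and the method proceeds to the state `σ'`, whose new search point `y_{t+1}` is the
`ω`-projection of `ŷ_t` on the level set `U_t`. -/
structure Step (Y : Set E) (ω : E → ℝ) (ω' : E → E) (g : E → E) (γ ε : ℝ) (yω : E)
    (σ : State E) (e : ℝ) (lam : ℕ → ℝ) (σ' : State E) : Prop where
  solves : SolvesAux Y g σ e lam
  not_done : ε < e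
  center_mem : proxCenter γ yω σ e ∈ subdiffDomain Y ω
  t_eq : σ'.t = σ.t + 1
  y_old : ∀ τ, τ ≠ σ.t + 1 → σ'.y τ = σ.y τ
  y_new : IsArgmin (levelSet Y g γ σ e lam)
    (fun z => ω z - inner ℝ (ω' (proxCenter γ yω σ e)) z) (σ'.y (σ.t + 1))
  I_eq : σ'.I = newI γ σ e lam
  gap_eq : σ'.gap = newGap γ σ e

/-- The states that the method can enter, whatever optimal weights `λ^t` the solver of the
auxiliary problems returns. -/
inductive Reachable (Y : Set E) (ω : E → ℝ) (ω' : E → E) (g : E → E) (γ ε : ℝ) (yω : E) :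
    State E → Prop
  | init : Reachable Y ω ω' g γ ε yω (initState yω)
  | step {σ σ' : State E} {e : ℝ} {lam : ℕ → ℝ} :
      Reachable Y ω ω' g γ ε yω σ → Step Y ω ω' g γ ε yω σ e lam σ' →
      Reachable Y ω ω' g γ ε yω σ'

/-- The method can terminate in state `σ` (that is, at step `σ.t`) with output
`(y_τ, g(y_τ))_{τ = 1}^t` and `λ^t = lam`: the step is entered, the auxiliary problem is solved
with outcome `(e, lam)`, and `e = ε_t ≤ ε`. -/
def TerminatesAt (Y : Set E) (ω : E → ℝ) (ω' : E → E) (g : E → E) (γ ε : ℝ) (yω : E)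
    (σ : State E) (lam : ℕ → ℝ) : Prop :=
  Reachable Y ω ω' g γ ε yω σ ∧ ∃ e, SolvesAux Y g σ e lam ∧ e ≤ ε

end

end MDL

/-!
Proximal points show that `Y^o` is dense in `Y`; since `ω'` is continuous and monotone, at a point
of `Y^o` it therefore dominates every other subgradient along the directions pointing into `Y`.
A theorem of the alternative (Sion's minimax theorem) yields multipliers for the level sets, which
satisfy Slater's condition because `γ < 1`, and so the projection `y_{t+1}` satisfies the
three-point inequality `V(y_{t+1}, u) + V(ŷ_t, y_{t+1}) ≤ V(ŷ_t, u)` for the Bregman distance `V`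
and all `u ∈ U_t`. As `‖y_{t+1} - ŷ_t‖ ≥ γ ε_t / L`, each step of a phase decreases the distance
to a common point of all its level sets by a multiple of `γ² ε_t² / L²`. The gaps of successive
phases shrink by the factor `γ`, hence the potential
`(t - 1) γ⁴ (1 - γ²) Δ² + (1 - γ²) 4 L² V(y_t, u)`, with `Δ` the gap of the current phase, stays
bounded by `2 Ω² L²` throughout.
-/

namespace MDL

section Duality

variable {ι E : Type*} [AddCommGroup E] [Module ℝ E] {Y : Set E} {f : E → ℝ} {Φ : ι → E → ℝ}

theorem convexOn_finsetSum_mul (hY : Convex ℝ Y) (s : Finset ι) {c : ι → ℝ}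
    (hc : ∀ i ∈ s, 0 ≤ c i) (hΦ : ∀ i ∈ s, ConvexOn ℝ Y (Φ i)) :
    ConvexOn ℝ Y fun z => ∑ i ∈ s, c i * Φ i z := by
  classical
  induction s using Finset.induction_on with
  | empty => simpa using convexOn_const 0 hY
  | insert i s hi ih =>
    simp only [Finset.sum_insert hi]
    rw [Finset.forall_mem_insert] at hc hΦ
    exact (hΦ.1.smul hc.1).add (ih hc.2 hΦ.2)

variable [TopologicalSpace E] [IsTopologicalAddGroup E] [ContinuousSMul ℝ E]

theorem exists_mem_stdSimplex_forall_sum_nonneg [Fintype ι] (hY : IsCompact Y)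
    (hYne : Y.Nonempty) (hconv : ∀ i, ConvexOn ℝ Y (Φ i)) (hcont : ∀ i, ContinuousOn (Φ i) Y)
    (hΦ : ∀ z ∈ Y, ∃ i, 0 ≤ Φ i z) :
    ∃ c ∈ stdSimplex ℝ ι, ∀ z ∈ Y, 0 ≤ ∑ i, c i * Φ i z := by
  classical
  obtain ⟨j, -⟩ := hΦ _ hYne.some_mem
  have hYc := (hconv j).1
  obtain ⟨z, hz, c, hc, hsaddle⟩ := Sion.exists_isSaddlePointOn (X := Y) (Y := stdSimplex ℝ ι)
    (f := fun z c => ∑ i, c i * Φ i z) hYne hYc hY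
    (fun c _ => ContinuousOn.lowerSemicontinuousOn (by fun_prop))
    (fun c hc =>
      (convexOn_finsetSum_mul hYc _ (fun i _ => hc.1 i) fun i _ => hconv i).quasiconvexOn)
    (convex_stdSimplex ℝ ι) ⟨_, single_mem_stdSimplex ℝ j⟩ (isCompact_stdSimplex ℝ ι)
    (fun z _ => ContinuousOn.upperSemicontinuousOn (by fun_prop))
    (fun z _ => ConcaveOn.quasiconcaveOn ⟨convex_stdSimplex ℝ ι, fun c _ d _ a b _ _ _ => by
      simp [add_mul, mul_assoc, Finset.sum_add_distrib, Finset.mul_sum]⟩)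
  obtain ⟨i, hi⟩ := hΦ z hz
  refine ⟨c, hc, fun w hw => hi.trans ?_⟩
  simpa [Pi.single_apply] using hsaddle w hw _ (single_mem_stdSimplex ℝ i)

theorem exists_weights_forall_sum_nonneg {s : Finset ι} (hY : IsCompact Y) (hYne : Y.Nonempty)
    (hconv : ∀ i ∈ s, ConvexOn ℝ Y (Φ i)) (hcont : ∀ i ∈ s, ContinuousOn (Φ i) Y)
    (hΦ : ∀ z ∈ Y, ∃ i ∈ s, 0 ≤ Φ i z) :
    ∃ c : ι → ℝ, (∀ i, 0 ≤ c i) ∧ (∀ i ∉ s, c i = 0) ∧ ∑ i ∈ s, c i = 1 ∧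
      ∀ z ∈ Y, 0 ≤ ∑ i ∈ s, c i * Φ i z := by
  classical
  obtain ⟨c, ⟨hc0, hc1⟩, hc⟩ := exists_mem_stdSimplex_forall_sum_nonneg (ι := s) hY hYne
    (fun i => hconv i i.2) (fun i => hcont i i.2) fun z hz =>
      let ⟨i, hi, h⟩ := hΦ z hz; ⟨⟨i, hi⟩, h⟩
  have hext (f : ι → ℝ) :
      ∑ i ∈ s, (if h : i ∈ s then c ⟨i, h⟩ else 0) * f i = ∑ i : s, c i * f i := by
    rw [← Finset.sum_coe_sort]
    exact Finset.sum_congr rfl fun i _ => by simp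
  refine ⟨fun i => if h : i ∈ s then c ⟨i, h⟩ else 0, fun i => ?_, fun i hi => dif_neg hi, ?_,
    fun z hz => ?_⟩
  · dsimp only
    split_ifs
    exacts [hc0 _, le_rfl]
  · simpa only [Pi.one_apply, mul_one, hc1] using hext 1
  · simpa only [hext] using hc z hz

theorem exists_multipliers_of_slater {s : Finset ι} {v : ℝ} (hY : IsCompact Y)
    (hf : ConvexOn ℝ Y f) (hfc : ContinuousOn f Y) (hconv : ∀ i ∈ s, ConvexOn ℝ Y (Φ i))
    (hcont : ∀ i ∈ s, ContinuousOn (Φ i) Y) (hslater : ∃ u ∈ Y, ∀ i ∈ s, Φ i u < 0)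
    (hv : ∀ z ∈ Y, (∀ i ∈ s, Φ i z ≤ 0) → v ≤ f z) :
    ∃ μ : ι → ℝ, (∀ i, 0 ≤ μ i) ∧ ∀ z ∈ Y, v ≤ f z + ∑ i ∈ s, μ i * Φ i z := by
  obtain ⟨u, hu, hΦu⟩ := hslater
  obtain ⟨c, hc0, -, hc1, hc⟩ := exists_weights_forall_sum_nonneg (s := Finset.insertNone s)
    (Φ := fun o => o.elim (fun z => f z - v) Φ) hY ⟨u, hu⟩
    (Finset.forall_mem_insertNone.2 ⟨hf.sub (concaveOn_const v hf.1), hconv⟩)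
    (Finset.forall_mem_insertNone.2 ⟨hfc.sub continuousOn_const, hcont⟩) (fun z hz => by
      by_cases h : ∀ i ∈ s, Φ i z ≤ 0
      · exact ⟨none, by simp, sub_nonneg.2 (hv z hz h)⟩
      · push Not at h
        obtain ⟨i, hi, h⟩ := h
        exact ⟨some i, by simpa using hi, h.le⟩)
  simp only [Finset.sum_insertNone, Option.elim_none, Option.elim_some] at hc1 hc
  have hpos : 0 < c none := by
    refine (hc0 none).lt_of_ne' fun h0 => ?_
    rw [h0, zero_add] at hc1
    obtain ⟨i, hi, hci⟩ : ∃ i ∈ s, 0 < c (some i) :=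
      Finset.exists_lt_of_sum_lt (by simp [hc1])
    refine (hc u hu).not_gt ?_
    rw [h0, zero_mul, zero_add]
    exact Finset.sum_neg' (fun j hj => mul_nonpos_of_nonneg_of_nonpos (hc0 _) (hΦu j hj).le)
      ⟨i, hi, mul_neg_of_pos_of_neg hci (hΦu i hi)⟩
  refine ⟨fun i => c (some i) / c none, fun i => div_nonneg (hc0 _) (hc0 _), fun z hz => ?_⟩
  have h := div_nonneg (hc z hz) hpos.le
  rw [add_div, mul_div_cancel_left₀ _ hpos.ne', Finset.sum_div] at h
  simp only [div_mul_eq_mul_div]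
  linarith

end Duality

section Argmin

variable {E : Type*} [NormedAddCommGroup E] [InnerProductSpace ℝ E] {Y : Set E} {ω : E → ℝ}

theorem exists_isArgmin {α : Type*} [TopologicalSpace α] {S : Set α} {f : α → ℝ}
    (hS : IsCompact S) (hSne : S.Nonempty) (hf : ContinuousOn f S) : ∃ x, IsArgmin S f x :=
  hS.exists_isMinOn hSne hf

theorem IsArgmin.zero_mem_subdiff {x : E} (hx : IsArgmin Y ω x) : (0 : E) ∈ subdiff Y ω x :=
  fun z hz => by simpa using hx.2 z hz

theorem IsArgmin.mem_subdiffDomain {x : E} (hx : IsArgmin Y ω x) : x ∈ subdiffDomain Y ω :=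
  ⟨hx.1, 0, hx.zero_mem_subdiff⟩

theorem isCompact_polyhedron {ι : Type*} {s : Finset ι} {a : ι → E} {b : ι → ℝ}
    (hY : IsCompact Y) : IsCompact {z ∈ Y | ∀ i ∈ s, inner ℝ (a i) z ≤ b i} := by
  have hcl : IsClosed {z : E | ∀ i ∈ s, inner ℝ (a i) z ≤ b i} := by
    simp only [Set.ofPred_forall]
    exact isClosed_biInter fun i _ => isClosed_le (by fun_prop) continuous_const
  exact hY.inter_right hcl

theorem IsArgmin.exists_mem_subdiff {ι : Type*} {s : Finset ι} {a : ι → E} {b : ι → ℝ} {ξ x : E}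
    (hY : IsCompact Y) (hω : ConvexOn ℝ Y ω) (hωc : ContinuousOn ω Y)
    (hslater : ∃ u ∈ Y, ∀ i ∈ s, inner ℝ (a i) u < b i)
    (hx : IsArgmin {z ∈ Y | ∀ i ∈ s, inner ℝ (a i) z ≤ b i} (fun z => ω z - inner ℝ ξ z) x) :
    ∃ ζ ∈ subdiff Y ω x, ∀ u ∈ Y, (∀ i ∈ s, inner ℝ (a i) u ≤ b i) →
      0 ≤ inner ℝ (ζ - ξ) (u - x) := by
  have hlin (v : E) : ConvexOn ℝ Y fun z => inner ℝ v z := (innerₛₗ ℝ v).convexOn hω.1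
  obtain ⟨μ, hμ0, hμ⟩ := exists_multipliers_of_slater (s := s) (v := ω x - inner ℝ ξ x)
    (Φ := fun i z => inner ℝ (a i) z - b i) hY (hω.sub ((innerₛₗ ℝ ξ).concaveOn hω.1))
    (hωc.sub (innerSL ℝ ξ).continuous.continuousOn)
    (fun i _ => (hlin (a i)).sub (concaveOn_const _ hω.1))
    (fun i _ => by fun_prop) (by simpa only [sub_neg] using hslater)
    (fun z hz hle => hx.2 z ⟨hz, fun i hi => sub_nonpos.1 (hle i hi)⟩)
  obtain ⟨hxY, hxs⟩ := hx.1
  have hnonpos {z : E} (hz : ∀ i ∈ s, inner ℝ (a i) z ≤ b i) :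
      ∑ i ∈ s, μ i * (inner ℝ (a i) z - b i) ≤ 0 :=
    Finset.sum_nonpos fun i hi => mul_nonpos_of_nonneg_of_nonpos (hμ0 i) (sub_nonpos.2 (hz i hi))
  have hslack : ∑ i ∈ s, μ i * (inner ℝ (a i) x - b i) = 0 :=
    (hnonpos hxs).antisymm (by simpa using hμ x hxY)
  have hsum (z : E) : inner ℝ (∑ i ∈ s, μ i • a i) (z - x) =
      ∑ i ∈ s, μ i * (inner ℝ (a i) z - b i) := by
    rw [← sub_zero (∑ i ∈ s, μ i * _), ← hslack, ← Finset.sum_sub_distrib, sum_inner]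
    refine Finset.sum_congr rfl fun i _ => ?_
    rw [real_inner_smul_left, inner_sub_right]
    ring
  refine ⟨ξ - ∑ i ∈ s, μ i • a i, fun z hz => ?_, fun u _ hu => ?_⟩
  · have := hμ z hz
    rw [inner_sub_left, hsum, inner_sub_right]
    simp only [Pi.sub_apply, innerₛₗ_apply_apply] at this
    linarith
  · rw [sub_sub_cancel_left, inner_neg_left, hsum]
    exact neg_nonneg.2 (hnonpos hu)

end Argmin

section Proximal

variable {E : Type*} [NormedAddCommGroup E] [InnerProductSpace ℝ E] {Y : Set E} {ω : E → ℝ}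

theorem IsArgmin.neg_mem_subdiff {φ : E → ℝ} {m ξ : E} (hω : ConvexOn ℝ Y ω)
    (hφ : HasFDerivAt φ (innerSL ℝ ξ) m) (hm : IsArgmin Y (fun z => ω z + φ z) m) :
    -ξ ∈ subdiff Y ω m := by
  intro z hz
  have hslope : ∀ t ∈ Set.Ioc (0 : ℝ) 1,
      ω m - ω z ≤ t⁻¹ • (φ (m + t • (z - m)) - φ m) := fun t ht => by
    have hmin := hm.2 _ (hω.1.add_smul_sub_mem hm.1 hz ⟨ht.1.le, ht.2⟩)
    have hconv := hω.2 hm.1 hz (sub_nonneg.2 ht.2) ht.1.le (by ring)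
    rw [show (1 - t) • m + t • z = m + t • (z - m) by module, smul_eq_mul, smul_eq_mul] at hconv
    rw [smul_eq_mul, inv_mul_eq_div, le_div_iff₀ ht.1]
    linarith
  have hlim := (hφ.hasLineDerivAt (z - m)).tendsto_slope_zero_right
  have := ge_of_tendsto hlim (Filter.mem_of_superset (Ioc_mem_nhdsGT zero_lt_one) hslope)
  rw [innerSL_apply_apply] at this
  rw [inner_neg_left]
  linarith

theorem exists_smul_sub_mem_subdiff (hY : IsCompact Y) (hYne : Y.Nonempty)
    (hω : ConvexOn ℝ Y ω) (hωc : ContinuousOn ω Y) (k : ℝ) (w : E) :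
    ∃ m ∈ Y, k • (w - m) ∈ subdiff Y ω m := by
  obtain ⟨m, hm⟩ := exists_isArgmin (f := fun z => ω z + k / 2 * ‖z - w‖ ^ 2) hY hYne (by fun_prop)
  have hderiv : HasFDerivAt (fun z => k / 2 * ‖z - w‖ ^ 2) (innerSL ℝ (k • (m - w))) m :=
    (((hasFDerivAt_id m).sub_const w).norm_sq.const_mul (k / 2)).congr_fderiv <| by
      ext v
      simp only [id_eq, map_sub, ContinuousLinearMap.comp_id, smul_apply, sub_apply,
        coe_innerSL_apply, nsmul_eq_mul, Nat.cast_ofNat, smul_eq_mul, map_smul]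
      ring
  refine ⟨m, hm.1, ?_⟩
  simpa [← smul_neg] using hm.neg_mem_subdiff hω hderiv

theorem exists_seq_smul_sub_mem_subdiff (hY : IsCompact Y) (hω : ConvexOn ℝ Y ω)
    (hωc : ContinuousOn ω Y) {w : E} (hw : w ∈ Y) :
    ∃ m : ℕ → E, (∀ n, m n ∈ Y) ∧ (∀ n : ℕ, (n : ℝ) • (w - m n) ∈ subdiff Y ω (m n)) ∧
      Filter.Tendsto m Filter.atTop (nhds w) := by
  choose m hm hsub using fun n : ℕ => exists_smul_sub_mem_subdiff hY ⟨w, hw⟩ hω hωc n w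
  refine ⟨m, hm, hsub, tendsto_iff_norm_sub_tendsto_zero.2 ?_⟩
  obtain ⟨x, hx⟩ := exists_isArgmin hY ⟨w, hw⟩ hωc
  have hle (n : ℕ) : n * ‖m n - w‖ ^ 2 ≤ ω w - ω x := by
    have := hsub n w hw
    rw [real_inner_smul_left, real_inner_self_eq_norm_sq, norm_sub_rev] at this
    linarith [hx.2 _ (hm n)]
  have hsq : Filter.Tendsto (fun n => ‖m n - w‖ ^ 2) Filter.atTop (nhds 0) := by
    refine squeeze_zero' (.of_forall fun n => sq_nonneg _) ?_
      (tendsto_const_div_atTop_nhds_zero_nat (ω w - ω x))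
    filter_upwards [Filter.eventually_gt_atTop 0] with n hn
    rw [le_div_iff₀' (Nat.cast_pos.2 hn)]
    exact hle n
  simpa [Real.sqrt_sq] using hsq.sqrt

theorem subset_closure_subdiffDomain (hY : IsCompact Y) (hω : ConvexOn ℝ Y ω)
    (hωc : ContinuousOn ω Y) : Y ⊆ closure (subdiffDomain Y ω) := fun w hw => by
  obtain ⟨m, hm, hsub, hlim⟩ := exists_seq_smul_sub_mem_subdiff hY hω hωc hw
  exact mem_closure_of_tendsto hlim (.of_forall fun n => ⟨hm n, _, hsub n⟩)

end Proximal

section Setup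

variable {E : Type*} [NormedAddCommGroup E] [InnerProductSpace ℝ E] {Y : Set E} {ω : E → ℝ}
  {ω' : E → E}

theorem inner_nonneg_of_mem_posTangentConeAt {S : Set E} {F : E → E} {y ξ v : E}
    (hF : ContinuousWithinAt F S y) (hmono : ∀ w ∈ S, 0 ≤ inner ℝ (F w - ξ) (w - y))
    (hv : v ∈ posTangentConeAt S y) : 0 ≤ inner ℝ (F y - ξ) v := by
  obtain ⟨α, l, hl, c, d, hd, hS, hcd⟩ := exists_fun_of_mem_tangentConeAt hv
  have hlim : Filter.Tendsto (fun n => y + d n) l (nhdsWithin y S) :=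
    tendsto_nhdsWithin_iff.2 ⟨by simpa using hd.const_add y, hS⟩
  refine ge_of_tendsto (((hF.tendsto.comp hlim).sub_const ξ).inner hcd) ?_
  filter_upwards [hS] with n hn
  have := hmono _ hn
  rw [add_sub_cancel_left] at this
  simpa [NNReal.smul_def, real_inner_smul_right] using mul_nonneg (c n).2 this

theorem inner_sub_nonneg_of_mem_subdiff {y w ξ ζ : E} (hy : y ∈ Y) (hw : w ∈ Y)
    (hξ : ξ ∈ subdiff Y ω y) (hζ : ζ ∈ subdiff Y ω w) : 0 ≤ inner ℝ (ζ - ξ) (w - y) := by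
  have hξw := hξ w hw
  have hζy := hζ y hy
  rw [← neg_sub w y, inner_neg_right] at hζy
  rw [inner_sub_left]
  linarith

theorem mem_subdiff_sub_inner {η ζ x : E} :
    ζ ∈ subdiff Y (fun z => ω z - inner ℝ η z) x ↔ ζ + η ∈ subdiff Y ω x := by
  refine forall₂_congr fun z _ => ?_
  rw [inner_add_left, inner_sub_right η]
  constructor <;> intro h <;> linarith

theorem IsProximalSetup.inner_le_selection {ν : Seminorm ℝ E} (hω : IsProximalSetup Y ν ω ω')
    (hY : IsCompact Y) {y z ξ : E} (hy : y ∈ Y) (hξ : ξ ∈ subdiff Y ω y) (hz : z ∈ Y) :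
    inner ℝ ξ (z - y) ≤ inner ℝ (ω' y) (z - y) := by
  have hv : z - y ∈ posTangentConeAt (subdiffDomain Y ω) y := by
    refine tangentConeAt_closure.subset (posTangentConeAt_mono ?_
      (sub_mem_posTangentConeAt_of_segment_subset (hω.convexOn.1.segment_subset hy hz)))
    exact subset_closure_subdiffDomain hY hω.convexOn hω.continuousOn
  rw [← sub_nonneg, ← inner_sub_left]
  exact inner_nonneg_of_mem_posTangentConeAt (hω.selection_continuousOn y ⟨hy, ξ, hξ⟩)
    (fun w hw => inner_sub_nonneg_of_mem_subdiff hy hw.1 hξ (hω.selection w hw)) hv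

/-- The Bregman distance from `y` to `z`, taken with respect to the selection `ω'`. -/
def bregman (ω : E → ℝ) (ω' : E → E) (y z : E) : ℝ :=
  ω z - ω y - inner ℝ (ω' y) (z - y)

theorem bregman_sub_bregman_sub_bregman (c x u : E) :
    bregman ω ω' c u - bregman ω ω' x u - bregman ω ω' c x = inner ℝ (ω' x - ω' c) (u - x) := by
  simp only [bregman, inner_sub_left, inner_sub_right]
  ring

theorem IsProximalSetup.bregman_nonneg {ν : Seminorm ℝ E} (hω : IsProximalSetup Y ν ω ω')
    {y z : E} (hy : y ∈ subdiffDomain Y ω) (hz : z ∈ Y) : 0 ≤ bregman ω ω' y z := by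
  rw [bregman]
  linarith [hω.selection y hy z hz]

theorem IsProximalSetup.bregman_le_of_isArgmin {ν : Seminorm ℝ E} (hω : IsProximalSetup Y ν ω ω')
    (hY : IsCompact Y) {y z : E} (hy : IsArgmin Y ω y) (hz : z ∈ Y) :
    bregman ω ω' y z ≤ ω z - ω y := by
  have := hω.inner_le_selection hY hy.1 hy.zero_mem_subdiff hz
  rw [inner_zero_left] at this
  rw [bregman]
  linarith

theorem IsProximalSetup.sq_sub_le_inner {ν : Seminorm ℝ E} (hω : IsProximalSetup Y ν ω ω')
    (hY : IsCompact Y) {y m ζ : E} (hy : y ∈ subdiffDomain Y ω) (hm : m ∈ Y)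
    (hζ : ζ ∈ subdiff Y ω m) : ν (m - y) ^ 2 ≤ inner ℝ (ζ - ω' y) (m - y) := by
  have hsel := hω.inner_le_selection hY hm hζ hy.1
  have hstrong := hω.strong m ⟨hm, ζ, hζ⟩ y hy
  rw [← neg_sub m y, inner_neg_right, inner_neg_right] at hsel
  rw [inner_sub_left] at hstrong ⊢
  linarith

theorem IsProximalSetup.sq_sub_le_bregman {ν : Seminorm ℝ E} (hω : IsProximalSetup Y ν ω ω')
    (hY : IsCompact Y) {y z m : E} (hy : y ∈ subdiffDomain Y ω) (hz : z ∈ Y) (hm : m ∈ Y) {k : ℝ}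
    (hk : 0 ≤ k) (hsub : k • (midpoint ℝ y z - m) + ω' y ∈ subdiff Y ω m) :
    ν (m - y) ^ 2 ≤ bregman ω ω' y z := by
  set w := midpoint ℝ y z with hw
  have hsplit : z - m = (m - y) + (2 : ℝ) • (w - m) := by
    rw [← add_sub_cancel_left y z, ← midpoint_add_self ℝ y z, ← hw]
    module
  calc ν (m - y) ^ 2 ≤ inner ℝ (k • (w - m)) (m - y) := by
        simpa only [add_sub_cancel_right] using hω.sq_sub_le_inner hY hy hm hsub
    _ ≤ inner ℝ (k • (w - m)) (m - y) + 2 * (k * ‖w - m‖ ^ 2) :=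
        le_add_of_nonneg_right (by positivity)
    _ = inner ℝ (k • (w - m)) (z - m) := by
        rw [hsplit, inner_add_right, real_inner_smul_right, real_inner_smul_left _ (w - m),
          real_inner_self_eq_norm_sq]
    _ ≤ bregman ω ω' y z := by
        have hmz := hsub z hz
        have hym := hω.selection y hy m hm
        rw [inner_add_left, ← sub_sub_sub_cancel_right z m y, inner_sub_right (ω' y)] at hmz
        rw [← sub_sub_sub_cancel_right z m y, bregman]
        linarith

-- Strong convexity gives the constant `2`; the midpoint argument loses a factor of two, which the
-- step bound of the method affords.
theorem IsProximalSetup.sq_le_bregman {ν : Seminorm ℝ E} (hω : IsProximalSetup Y ν ω ω')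
    (hY : IsCompact Y) (hν : Continuous ν) {y z : E} (hy : y ∈ subdiffDomain Y ω) (hz : z ∈ Y) :
    ν (z - y) ^ 2 ≤ 4 * bregman ω ω' y z := by
  obtain ⟨m, hm, hsub, hlim⟩ := exists_seq_smul_sub_mem_subdiff hY
    (hω.convexOn.sub ((innerₛₗ ℝ (ω' y)).concaveOn hω.convexOn.1))
    (hω.continuousOn.sub (innerSL ℝ (ω' y)).continuous.continuousOn)
    (hω.convexOn.1.midpoint_mem hy.1 hz)
  have hle (n : ℕ) : ν (m n - y) ^ 2 ≤ bregman ω ω' y z :=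
    hω.sq_sub_le_bregman hY hy hz (hm n) n.cast_nonneg (mem_subdiff_sub_inner.1 (hsub n))
  have hνlim : Filter.Tendsto (fun n => ν (m n - y) ^ 2) Filter.atTop
      (nhds (ν (midpoint ℝ y z - y) ^ 2)) :=
    ((hν.tendsto _).comp (hlim.sub_const y)).pow 2
  have hhalf : ν (midpoint ℝ y z - y) = ν (z - y) / 2 := by
    rw [midpoint_sub_left, map_smul_eq_mul, invOf_eq_inv, norm_inv, Real.norm_ofNat,
      inv_mul_eq_div]
  have := le_of_tendsto' hνlim hle
  rw [hhalf] at this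
  linarith

theorem IsProximalSetup.eq_of_bregman_nonpos {ν : Seminorm ℝ E} (hω : IsProximalSetup Y ν ω ω')
    (hY : IsCompact Y) (hν : Continuous ν) {y z : E} (hy : y ∈ subdiffDomain Y ω) (hz : z ∈ Y)
    (h : bregman ω ω' y z ≤ 0) : z = y := by
  have := hω.sq_le_bregman hY hν hy hz
  have h0 : ν (z - y) ^ 2 = 0 := by linarith [sq_nonneg (ν (z - y))]
  exact sub_eq_zero.1 (hω.norm_definite _ (pow_eq_zero_iff two_ne_zero |>.1 h0))

variable {ι : Type*} {s : Finset ι} {a : ι → E} {b : ι → ℝ}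

theorem IsProximalSetup.mem_subdiffDomain_and_bregman_add_le {ν : Seminorm ℝ E}
    (hω : IsProximalSetup Y ν ω ω') (hY : IsCompact Y) {c x : E}
    (hslater : ∃ u ∈ Y, ∀ i ∈ s, inner ℝ (a i) u < b i)
    (hx : IsArgmin {z ∈ Y | ∀ i ∈ s, inner ℝ (a i) z ≤ b i} (fun z => ω z - inner ℝ (ω' c) z) x) :
    x ∈ subdiffDomain Y ω ∧ ∀ u ∈ Y, (∀ i ∈ s, inner ℝ (a i) u ≤ b i) →
      bregman ω ω' x u + bregman ω ω' c x ≤ bregman ω ω' c u := by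
  obtain ⟨ζ, hζ, hopt⟩ := hx.exists_mem_subdiff hY hω.convexOn hω.continuousOn hslater
  refine ⟨⟨hx.1.1, ζ, hζ⟩, fun u hu hau => ?_⟩
  have hsel := hω.inner_le_selection hY hx.1.1 hζ hu
  have hopt := hopt u hu hau
  have hthree := bregman_sub_bregman_sub_bregman (ω := ω) (ω' := ω') c x u
  rw [inner_sub_left] at hopt hthree
  linarith

theorem IsProximalSetup.argmin_polyhedron_unique {ν : Seminorm ℝ E}
    (hω : IsProximalSetup Y ν ω ω') (hY : IsCompact Y) (hν : Continuous ν) {c x x' : E}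
    (hslater : ∃ u ∈ Y, ∀ i ∈ s, inner ℝ (a i) u < b i)
    (hx : IsArgmin {z ∈ Y | ∀ i ∈ s, inner ℝ (a i) z ≤ b i} (fun z => ω z - inner ℝ (ω' c) z) x)
    (hx' : IsArgmin {z ∈ Y | ∀ i ∈ s, inner ℝ (a i) z ≤ b i}
      (fun z => ω z - inner ℝ (ω' c) z) x') : x' = x := by
  obtain ⟨hxo, hopt⟩ := hω.mem_subdiffDomain_and_bregman_add_le hY hslater hx
  have hbreg := hopt x' hx'.1.1 hx'.1.2
  have hmin := hx'.2 x hx.1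
  refine hω.eq_of_bregman_nonpos hY hν hxo hx'.1.1 ?_
  simp only [bregman, inner_sub_right] at hbreg ⊢
  linarith

theorem IsProximalSetup.argmin_unique {ν : Seminorm ℝ E} (hω : IsProximalSetup Y ν ω ω')
    (hY : IsCompact Y) (hν : Continuous ν) {x x' : E} (hx : IsArgmin Y ω x)
    (hx' : IsArgmin Y ω x') : x' = x :=
  hω.eq_of_bregman_nonpos hY hν hx.mem_subdiffDomain hx'.1 <|
    (hω.bregman_le_of_isArgmin hY hx hx'.1).trans (sub_nonpos.2 (hx'.2 x hx.1))

end Setup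

section DualNorm

variable {E : Type*} [NormedAddCommGroup E] [InnerProductSpace ℝ E] [FiniteDimensional ℝ E]
  {ν : Seminorm ℝ E}

theorem continuous_seminorm (ν : Seminorm ℝ E) : Continuous ν :=
  continuousOn_univ.1 (ν.convexOn.continuousOn isOpen_univ)

theorem exists_pos_mul_norm_le (hν : ∀ x, ν x = 0 → x = 0) : ∃ c > 0, ∀ x, c * ‖x‖ ≤ ν x := by
  obtain ⟨c, hc, hle⟩ := (isCompact_sphere (0 : E) 1).exists_forall_le' (a := 0)
    (continuous_seminorm ν).continuousOn fun x hx => (apply_nonneg ν x).lt_of_ne' fun h => by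
      simp [hν x h] at hx
  refine ⟨c, hc, fun x => ?_⟩
  rcases eq_or_ne x 0 with rfl | hx
  · simp
  have := hle (‖x‖⁻¹ • x) (by simp [norm_smul, hx])
  rwa [map_smul_eq_mul, norm_inv, norm_norm, inv_mul_eq_div, le_div_iff₀ (norm_pos_iff.2 hx)]
    at this

theorem bddAbove_image_inner (hν : ∀ x, ν x = 0 → x = 0) (ξ : E) :
    BddAbove ((fun x => inner ℝ ξ x) '' {x | ν x ≤ 1}) := by
  obtain ⟨c, hc, hle⟩ := exists_pos_mul_norm_le hν
  refine ⟨‖ξ‖ * c⁻¹, ?_⟩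
  rintro _ ⟨x, hx, rfl⟩
  have : ‖x‖ ≤ c⁻¹ := by
    rw [← one_div, le_div_iff₀' hc]
    exact (hle x).trans hx
  exact (real_inner_le_norm ξ x).trans (by gcongr)

theorem inner_le_dualNorm_mul (hν : ∀ x, ν x = 0 → x = 0) (ξ x : E) :
    inner ℝ ξ x ≤ dualNorm ν ξ * ν x := by
  rcases (apply_nonneg ν x).eq_or_lt with h | h
  · simp [hν x h.symm]
  have : inner ℝ ξ ((ν x)⁻¹ • x) ≤ dualNorm ν ξ :=
    le_csSup (bddAbove_image_inner hν ξ) ⟨_, by simp [map_smul_eq_mul, h.ne', abs_of_pos h], rfl⟩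
  rwa [real_inner_smul_right, inv_mul_le_iff₀' h] at this

end DualNorm

section Auxiliary

variable {E : Type*} [NormedAddCommGroup E] [InnerProductSpace ℝ E] {Y : Set E} {g : E → E}
  {σ : State E} {e : ℝ} {lam : ℕ → ℝ}

theorem le_affineAt_iff {c : ℝ} {p z : E} :
    c ≤ affineAt g p z ↔ inner ℝ (g p) z ≤ inner ℝ (g p) p - c := by
  rw [affineAt, inner_sub_right, le_sub_comm]

theorem lt_affineAt_iff {c : ℝ} {p z : E} :
    c < affineAt g p z ↔ inner ℝ (g p) z < inner ℝ (g p) p - c := by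
  rw [affineAt, inner_sub_right, lt_sub_comm]

theorem continuous_affineAt (g : E → E) (p : E) : Continuous (affineAt g p) := by
  unfold affineAt
  fun_prop

theorem concaveOn_affineAt (hY : Convex ℝ Y) (g : E → E) (p : E) :
    ConcaveOn ℝ Y (affineAt g p) := by
  simp only [funext (affineAt.eq_def g p), inner_sub_right]
  exact (concaveOn_const _ hY).sub ((innerₛₗ ℝ (g p)).convexOn hY)

theorem exists_isGreatest_inf'_affineAt (hY : IsCompact Y) (hYne : Y.Nonempty) (g : E → E)
    (σ : State E) :
    ∃ e, IsGreatest ((fun z => σ.Iplus.inf' (Finset.insert_nonempty _ _)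
      fun τ => affineAt g (σ.y τ) z) '' Y) e :=
  (hY.image (Continuous.finset_inf'_apply _ fun τ _ =>
    continuous_affineAt g (σ.y τ))).exists_isGreatest (hYne.image _)

theorem exists_solvesAux (hY : IsCompact Y) (hYne : Y.Nonempty) (hYc : Convex ℝ Y) (g : E → E)
    (σ : State E) : ∃ e lam, SolvesAux Y g σ e lam := by
  obtain ⟨e, he⟩ := exists_isGreatest_inf'_affineAt hY hYne g σ
  obtain ⟨lam, hnonneg, hsupport, hsum, hlam⟩ := exists_weights_forall_sum_nonneg (s := σ.Iplus)
    (Φ := fun τ z => e - affineAt g (σ.y τ) z) hY hYne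
    (fun τ _ => (convexOn_const e hYc).sub (concaveOn_affineAt hYc g _))
    (fun τ _ => (continuous_const.sub (continuous_affineAt g _)).continuousOn) fun z hz => by
      simpa only [sub_nonneg] using (Finset.inf'_le_iff _).1 (he.2 ⟨z, hz, rfl⟩)
  have hle : ∀ z ∈ Y, ∑ τ ∈ σ.Iplus, lam τ * affineAt g (σ.y τ) z ≤ e := fun z hz => by
    simpa [mul_sub, ← Finset.sum_mul, hsum] using hlam z hz
  obtain ⟨w, hw, hwe⟩ := he.1
  refine ⟨e, lam, he, hnonneg, hsupport, hsum, ⟨w, hw, (hle w hw).antisymm ?_⟩, ?_⟩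
  · calc e = ∑ τ ∈ σ.Iplus, lam τ * e := by rw [← Finset.sum_mul, hsum, one_mul]
      _ ≤ ∑ τ ∈ σ.Iplus, lam τ * affineAt g (σ.y τ) w :=
        Finset.sum_le_sum fun τ hτ => mul_le_mul_of_nonneg_left
          (hwe ▸ Finset.inf'_le _ hτ) (hnonneg τ)
  · rintro _ ⟨z, hz, rfl⟩
    exact hle z hz

theorem SolvesAux.exists_le (h : SolvesAux Y g σ e lam) :
    ∃ u ∈ Y, ∀ τ ∈ σ.Iplus, e ≤ affineAt g (σ.y τ) u := by
  obtain ⟨u, hu, he⟩ := h.value.1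
  exact ⟨u, hu, fun τ hτ => he ▸ Finset.inf'_le _ hτ⟩

theorem SolvesAux.exists_ge (h : SolvesAux Y g σ e lam) {z : E} (hz : z ∈ Y) :
    ∃ τ ∈ σ.Iplus, 0 < lam τ ∧ affineAt g (σ.y τ) z ≤ e := by
  by_contra! hcon
  obtain ⟨τ₀, hτ₀, hpos₀⟩ : ∃ τ ∈ σ.Iplus, 0 < lam τ :=
    Finset.exists_lt_of_sum_lt (by simp [h.sum_eq_one])
  have hlt : ∑ τ ∈ σ.Iplus, lam τ * e < ∑ τ ∈ σ.Iplus, lam τ * affineAt g (σ.y τ) z := by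
    refine Finset.sum_lt_sum (fun τ hτ => ?_)
      ⟨τ₀, hτ₀, mul_lt_mul_of_pos_left (hcon τ₀ hτ₀ hpos₀) hpos₀⟩
    rcases (h.nonneg τ).eq_or_lt with h0 | h0
    · simp [← h0]
    · exact (mul_lt_mul_of_pos_left (hcon τ hτ h0) h0).le
  rw [← Finset.sum_mul, h.sum_eq_one, one_mul] at hlt
  exact (h.weights.2 ⟨z, hz, rfl⟩).not_gt hlt

theorem SolvesAux.isCertificate (h : SolvesAux Y g σ e lam)
    (hsub : σ.Iplus ⊆ Finset.Icc 1 σ.t) : IsCertificate σ.t lam :=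
  ⟨fun τ _ => h.nonneg τ,
    h.sum_eq_one ▸ (Finset.sum_subset hsub fun τ _ hτ => h.support τ hτ).symm⟩

theorem SolvesAux.isGreatest_certificateValues (h : SolvesAux Y g σ e lam)
    (hsub : σ.Iplus ⊆ Finset.Icc 1 σ.t) :
    IsGreatest (certificateValues Y g σ.t σ.y lam) e := by
  have hsum (z : E) : ∑ τ ∈ Finset.Icc 1 σ.t, lam τ * affineAt g (σ.y τ) z =
      ∑ τ ∈ σ.Iplus, lam τ * affineAt g (σ.y τ) z :=
    (Finset.sum_subset hsub fun τ _ hτ => by rw [h.support τ hτ, zero_mul]).symm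
  simpa only [certificateValues, hsum] using h.weights

end Auxiliary

theorem startsPhase_of_gap_eq_top {E : Type*} {γ e : ℝ} {σ : State E} (hγ : 0 < γ)
    (h : σ.gap = ⊤) : StartsPhase γ σ e := by
  rw [StartsPhase, h, EReal.coe_mul_top_of_pos hγ]
  exact le_top

theorem startsPhase_iff {E : Type*} {γ e Δ : ℝ} {σ : State E} (h : σ.gap = Δ) :
    StartsPhase γ σ e ↔ e ≤ γ * Δ := by
  rw [StartsPhase, h]
  exact_mod_cast Iff.rfl

section Method

variable {E : Type*} [NormedAddCommGroup E] [InnerProductSpace ℝ E] {Y : Set E} {ν : Seminorm ℝ E}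
  {ω : E → ℝ} {ω' : E → E} {g : E → E} {L γ ε : ℝ} {yω : E} {σ σ' : State E} {e : ℝ} {lam : ℕ → ℝ}

theorem levelSet_eq : levelSet Y g γ σ e lam = {z ∈ Y | ∀ τ ∈ newI γ σ e lam,
    inner ℝ (g (σ.y τ)) z ≤ inner ℝ (g (σ.y τ)) (σ.y τ) - γ * e} := by
  simp only [levelSet, le_affineAt_iff]

/-- The standing assumptions on the data of the method, for an arbitrary inner product space. The
bound `‖g(y)‖_* ≤ L` is expressed by `bound`, which needs no supremum. -/
structure StandingAssumptions (Y : Set E) (ν : Seminorm ℝ E) (ω : E → ℝ) (ω' : E → E) (g : E → E)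
    (L γ ε : ℝ) (yω : E) : Prop where
  isCompact : IsCompact Y
  setup : IsProximalSetup Y ν ω ω'
  continuous_norm : Continuous ν
  bound : ∀ y ∈ Y, ∀ x, inner ℝ (g y) x ≤ L * ν x
  γ_pos : 0 < γ
  γ_lt_one : γ < 1
  ε_pos : 0 < ε
  center : IsArgmin Y ω yω

theorem StandingAssumptions.one_sub_sq_pos (H : StandingAssumptions Y ν ω ω' g L γ ε yω) :
    0 < 1 - γ ^ 2 :=
  sub_pos.2 (pow_lt_one₀ H.γ_pos.le H.γ_lt_one two_ne_zero)

/-- The index sets and search points of a state are consistent: this part of the invariant of the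
method makes the next step possible. -/
structure IsConsistent (Y : Set E) (ω : E → ℝ) (yω : E) (σ : State E) : Prop where
  one_mem : 1 ∈ σ.Iplus
  subset : σ.Iplus ⊆ Finset.Icc 1 σ.t
  mem_domain : ∀ τ ∈ Finset.Icc 1 σ.t, σ.y τ ∈ subdiffDomain Y ω
  y_one : σ.y 1 = yω

theorem isConsistent_initState (hc : IsArgmin Y ω yω) : IsConsistent Y ω yω (initState yω) where
  one_mem := by simp [State.Iplus, initState]
  subset := by simp [State.Iplus, initState]
  mem_domain _ _ := hc.mem_subdiffDomain
  y_one := rfl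

theorem IsConsistent.t_mem (hσ : IsConsistent Y ω yω σ) : σ.t ∈ Finset.Icc 1 σ.t :=
  hσ.subset (Finset.mem_insert_self _ _)

theorem IsConsistent.one_le_t (hσ : IsConsistent Y ω yω σ) : 1 ≤ σ.t :=
  (Finset.mem_Icc.1 hσ.t_mem).1

theorem IsConsistent.newI_subset (hσ : IsConsistent Y ω yω σ) (h : SolvesAux Y g σ e lam) :
    newI γ σ e lam ⊆ σ.Iplus := by
  unfold newI
  split_ifs
  · refine Finset.union_subset (fun τ hτ => ?_) (Finset.singleton_subset_iff.2 hσ.one_mem)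
    by_contra hn
    exact (Finset.mem_filter.1 hτ).2.ne' (h.support τ hn)
  · exact subset_rfl

theorem IsConsistent.one_mem_newI (hσ : IsConsistent Y ω yω σ) : 1 ∈ newI γ σ e lam := by
  unfold newI
  split_ifs
  · simp
  · exact hσ.one_mem

theorem IsConsistent.exists_proxCenter_eq (hσ : IsConsistent Y ω yω σ) :
    ∃ τ ∈ newI γ σ e lam, τ ∈ Finset.Icc 1 σ.t ∧ proxCenter γ yω σ e = σ.y τ := by
  by_cases hs : StartsPhase γ σ e
  · exact ⟨1, hσ.one_mem_newI, hσ.subset hσ.one_mem, by simp [proxCenter, hs, hσ.y_one]⟩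
  · exact ⟨σ.t, by simp [newI, hs, State.Iplus], hσ.t_mem, by simp [proxCenter, hs]⟩

theorem IsConsistent.proxCenter_mem (hσ : IsConsistent Y ω yω σ) :
    proxCenter γ yω σ e ∈ subdiffDomain Y ω := by
  obtain ⟨τ, -, hτ, heq⟩ := hσ.exists_proxCenter_eq (γ := γ) (e := e) (lam := 0)
  exact heq ▸ hσ.mem_domain τ hτ

theorem IsConsistent.slater (hσ : IsConsistent Y ω yω σ) (h : SolvesAux Y g σ e lam)
    (hγ : γ < 1) (he : 0 < e) :
    ∃ u ∈ Y, ∀ τ ∈ newI γ σ e lam,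
      inner ℝ (g (σ.y τ)) u < inner ℝ (g (σ.y τ)) (σ.y τ) - γ * e := by
  obtain ⟨u, hu, hmax⟩ := h.exists_le
  refine ⟨u, hu, fun τ hτ => lt_affineAt_iff.1 ?_⟩
  exact (mul_lt_of_lt_one_left he hγ).trans_le (hmax τ (hσ.newI_subset h hτ))

theorem StandingAssumptions.existsUnique_argmin_levelSet
    (H : StandingAssumptions Y ν ω ω' g L γ ε yω) (hσ : IsConsistent Y ω yω σ)
    (h : SolvesAux Y g σ e lam) (he : ε < e) (c : E) :
    ∃! x, IsArgmin (levelSet Y g γ σ e lam) (fun z => ω z - inner ℝ (ω' c) z) x := by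
  have hslater := hσ.slater h H.γ_lt_one (H.ε_pos.trans he)
  rw [levelSet_eq]
  have hcont := H.setup.continuousOn.sub (innerSL ℝ (ω' c)).continuous.continuousOn
  obtain ⟨u, hu, hlt⟩ := hslater
  obtain ⟨x, hx⟩ := exists_isArgmin (isCompact_polyhedron H.isCompact)
    ⟨u, hu, fun τ hτ => (hlt τ hτ).le⟩ (hcont.mono fun z hz => hz.1)
  exact ⟨x, hx, fun x' hx' => H.setup.argmin_polyhedron_unique H.isCompact H.continuous_norm
    ⟨u, hu, hlt⟩ hx hx'⟩

theorem StandingAssumptions.existsUnique_step (H : StandingAssumptions Y ν ω ω' g L γ ε yω)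
    (hσ : IsConsistent Y ω yω σ) (h : SolvesAux Y g σ e lam) (he : ε < e) :
    ∃! σ', Step Y ω ω' g γ ε yω σ e lam σ' := by
  obtain ⟨x, hx, huniq⟩ := H.existsUnique_argmin_levelSet hσ h he (proxCenter γ yω σ e)
  refine ⟨⟨σ.t + 1, Function.update σ.y (σ.t + 1) x, newI γ σ e lam, newGap γ σ e⟩,
    ⟨h, he, hσ.proxCenter_mem, rfl, fun τ hτ => Function.update_of_ne hτ _ _, ?_, rfl, rfl⟩, ?_⟩
  · simpa only [Function.update_self] using hx
  · rintro ⟨t, y, I, gap⟩ hst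
    obtain rfl : t = σ.t + 1 := hst.t_eq
    obtain rfl : I = newI γ σ e lam := hst.I_eq
    obtain rfl : gap = newGap γ σ e := hst.gap_eq
    have hy : y = Function.update σ.y (σ.t + 1) x :=
      Function.eq_update_iff.2 ⟨huniq _ hst.y_new, hst.y_old⟩
    rw [hy]

theorem Step.y_eq (h : Step Y ω ω' g γ ε yω σ e lam σ') {τ : ℕ} (hτ : τ ∈ Finset.Icc 1 σ.t) :
    σ'.y τ = σ.y τ :=
  h.y_old τ (Nat.lt_succ_of_le (Finset.mem_Icc.1 hτ).2).ne

theorem Step.y_eq_of_mem_newI (h : Step Y ω ω' g γ ε yω σ e lam σ') (hσ : IsConsistent Y ω yω σ)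
    {τ : ℕ} (hτ : τ ∈ newI γ σ e lam) : σ'.y τ = σ.y τ :=
  h.y_eq (hσ.subset (hσ.newI_subset h.solves hτ))

theorem Step.mem_subdiffDomain_and_bregman_add_le (H : StandingAssumptions Y ν ω ω' g L γ ε yω)
    (hσ : IsConsistent Y ω yω σ) (h : Step Y ω ω' g γ ε yω σ e lam σ') :
    σ'.y σ'.t ∈ subdiffDomain Y ω ∧ ∀ u ∈ levelSet Y g γ σ e lam,
      bregman ω ω' (σ'.y σ'.t) u + bregman ω ω' (proxCenter γ yω σ e) (σ'.y σ'.t) ≤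
        bregman ω ω' (proxCenter γ yω σ e) u := by
  have hslater := hσ.slater h.solves H.γ_lt_one (H.ε_pos.trans h.not_done)
  have hnew := h.y_new
  rw [levelSet_eq, ← h.t_eq] at hnew
  rw [levelSet_eq]
  obtain ⟨hmem, hle⟩ := H.setup.mem_subdiffDomain_and_bregman_add_le H.isCompact hslater hnew
  exact ⟨hmem, fun u hu => hle u hu.1 hu.2⟩

theorem Step.isConsistent (H : StandingAssumptions Y ν ω ω' g L γ ε yω)
    (hσ : IsConsistent Y ω yω σ) (h : Step Y ω ω' g γ ε yω σ e lam σ') :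
    IsConsistent Y ω yω σ' where
  one_mem := Finset.mem_insert_of_mem (h.I_eq ▸ hσ.one_mem_newI)
  subset := by
    rw [State.Iplus, h.I_eq, h.t_eq]
    refine Finset.insert_subset (by simp) ?_
    exact (hσ.newI_subset h.solves).trans
      (hσ.subset.trans (Finset.Icc_subset_Icc_right (Nat.le_succ _)))
  mem_domain τ hτ := by
    rw [h.t_eq, ← Finset.insert_Icc_right_eq_Icc_add_one (by omega), Finset.mem_insert] at hτ
    rcases hτ with rfl | hτ
    · exact h.t_eq ▸ (h.mem_subdiffDomain_and_bregman_add_le H hσ).1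
    · exact h.y_eq hτ ▸ hσ.mem_domain τ hτ
  y_one := by rw [h.y_eq (Finset.mem_Icc.2 ⟨le_rfl, hσ.one_le_t⟩), hσ.y_one]

theorem Step.sq_le_bregman (H : StandingAssumptions Y ν ω ω' g L γ ε yω)
    (hσ : IsConsistent Y ω yω σ) (h : Step Y ω ω' g γ ε yω σ e lam σ') :
    γ ^ 2 * e ^ 2 ≤ 4 * L ^ 2 * bregman ω ω' (proxCenter γ yω σ e) (σ'.y σ'.t) := by
  obtain ⟨τ, hτI, -, heq⟩ := hσ.exists_proxCenter_eq (γ := γ) (e := e) (lam := lam)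
  obtain ⟨hxY, hlevel⟩ := h.y_new.1
  rw [← h.t_eq] at hxY hlevel
  set c := proxCenter γ yω σ e
  set x := σ'.y σ'.t
  have hν : γ * e ≤ L * ν (x - c) :=
    calc γ * e ≤ inner ℝ (g c) (c - x) := heq ▸ hlevel τ hτI
      _ ≤ L * ν (c - x) := H.bound c h.center_mem.1 _
      _ = L * ν (x - c) := by rw [map_sub_rev]
  calc γ ^ 2 * e ^ 2 = (γ * e) ^ 2 := (mul_pow _ _ _).symm
    _ ≤ (L * ν (x - c)) ^ 2 :=
      pow_le_pow_left₀ (mul_nonneg H.γ_pos.le (H.ε_pos.trans h.not_done).le) hν 2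
    _ = L ^ 2 * ν (x - c) ^ 2 := mul_pow _ _ _
    _ ≤ L ^ 2 * (4 * bregman ω ω' c x) := by
      gcongr
      exact H.setup.sq_le_bregman H.isCompact H.continuous_norm h.center_mem hxY
    _ = 4 * L ^ 2 * bregman ω ω' c x := by ring

theorem Step.bregman_add_le (H : StandingAssumptions Y ν ω ω' g L γ ε yω)
    (hσ : IsConsistent Y ω yω σ) (h : Step Y ω ω' g γ ε yω σ e lam σ') {u : E}
    (hu : u ∈ levelSet Y g γ σ e lam) :
    4 * L ^ 2 * bregman ω ω' (σ'.y σ'.t) u + γ ^ 2 * e ^ 2 ≤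
      4 * L ^ 2 * bregman ω ω' (proxCenter γ yω σ e) u := by
  have hprox := (h.mem_subdiffDomain_and_bregman_add_le H hσ).2 u hu
  have hmul := mul_le_mul_of_nonneg_left hprox (by positivity : 0 ≤ 4 * L ^ 2)
  linarith [h.sq_le_bregman H hσ]

theorem StandingAssumptions.le_omegaDiam_sq (H : StandingAssumptions Y ν ω ω' g L γ ε yω) {u : E}
    (hu : u ∈ Y) : 2 * (ω u - ω yω) ≤ omegaDiam Y ω ^ 2 := by
  have himage := H.isCompact.image_of_continuousOn H.setup.continuousOn
  have hmax : ω u ≤ sSup (ω '' Y) := le_csSup himage.bddAbove ⟨u, hu, rfl⟩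
  have hmin : sInf (ω '' Y) ≤ ω yω := csInf_le himage.bddBelow ⟨yω, H.center.1, rfl⟩
  have hcenter := H.center.2 u hu
  rw [omegaDiam, Real.sq_sqrt (by linarith)]
  linarith

theorem StandingAssumptions.bregman_center_le (H : StandingAssumptions Y ν ω ω' g L γ ε yω)
    {u : E} (hu : u ∈ Y) :
    4 * L ^ 2 * bregman ω ω' yω u ≤ 2 * omegaDiam Y ω ^ 2 * L ^ 2 := by
  have hbreg := H.setup.bregman_le_of_isArgmin H.isCompact H.center hu
  have hdiam := H.le_omegaDiam_sq hu
  have := mul_le_mul_of_nonneg_left (by linarith : 2 * bregman ω ω' yω u ≤ omegaDiam Y ω ^ 2)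
    (sq_nonneg L)
  linarith

theorem Step.forall_mem_I_iff (hσ : IsConsistent Y ω yω σ)
    (h : Step Y ω ω' g γ ε yω σ e lam σ') (P : E → Prop) :
    (∀ τ ∈ σ'.I, P (σ'.y τ)) ↔ ∀ τ ∈ newI γ σ e lam, P (σ.y τ) := by
  rw [h.I_eq]
  exact forall₂_congr fun τ hτ => by rw [h.y_eq_of_mem_newI hσ hτ]

theorem Step.exists_mem_I_iff (hσ : IsConsistent Y ω yω σ)
    (h : Step Y ω ω' g γ ε yω σ e lam σ') (P : E → Prop) :
    (∃ τ ∈ σ'.I, P (σ'.y τ)) ↔ ∃ τ ∈ newI γ σ e lam, P (σ.y τ) := by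
  simpa only [not_forall, not_not, exists_prop] using
    not_congr (h.forall_mem_I_iff hσ fun y => ¬ P y)

/-- A state in which a phase with gap `Δ` is under way. The level sets of the phase have a common
point, and a potential, made of the number of all the steps made so far and of the Bregman
distance to any such point, is bounded by `2 Ω² L²`. -/
structure InPhase (Y : Set E) (ω : E → ℝ) (ω' : E → E) (g : E → E) (L γ ε : ℝ)
    (σ : State E) (Δ : ℝ) : Prop where
  gap_eq : σ.gap = (Δ : EReal)
  lt_gap : ε < Δ
  exists_common : ∃ u ∈ Y, ∀ τ ∈ σ.I, γ * Δ ≤ affineAt g (σ.y τ) u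
  exists_le : ∀ z ∈ Y, ∃ τ ∈ σ.I, affineAt g (σ.y τ) z ≤ Δ
  potential_le : ∀ u ∈ Y, (∀ τ ∈ σ.I, γ * Δ ≤ affineAt g (σ.y τ) u) →
    ((σ.t : ℝ) - 1) * (γ ^ 4 * (1 - γ ^ 2) * Δ ^ 2) +
        (1 - γ ^ 2) * (4 * L ^ 2 * bregman ω ω' (σ.y σ.t) u) ≤
      2 * omegaDiam Y ω ^ 2 * L ^ 2

/-- The invariant of the method: no step has been made, or a phase is under way. -/
structure Invariant (Y : Set E) (ω : E → ℝ) (ω' : E → E) (g : E → E) (L γ ε : ℝ) (yω : E)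
    (σ : State E) : Prop where
  consistent : IsConsistent Y ω yω σ
  phase : (σ.t = 1 ∧ σ.gap = ⊤) ∨ ∃ Δ, InPhase Y ω ω' g L γ ε σ Δ

theorem InPhase.steps_mul_le (H : StandingAssumptions Y ν ω ω' g L γ ε yω)
    (hσ : IsConsistent Y ω yω σ) {Δ : ℝ} (h : InPhase Y ω ω' g L γ ε σ Δ) :
    ((σ.t : ℝ) - 1) * (γ ^ 4 * (1 - γ ^ 2) * Δ ^ 2) ≤ 2 * omegaDiam Y ω ^ 2 * L ^ 2 := by
  obtain ⟨u, hu, hcommon⟩ := h.exists_common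
  have hbreg := H.setup.bregman_nonneg (hσ.mem_domain _ hσ.t_mem) hu
  have hpos := H.one_sub_sq_pos
  exact (le_add_of_nonneg_right (by positivity)).trans (h.potential_le u hu hcommon)

-- Starting a phase shrinks the gap by the factor `γ`, so that all earlier steps together use up
-- at most the share `γ²` of the bound on the potential.
theorem Invariant.steps_mul_le_of_startsPhase (H : StandingAssumptions Y ν ω ω' g L γ ε yω)
    (hσ : Invariant Y ω ω' g L γ ε yω σ) (hs : StartsPhase γ σ e) (he : 0 ≤ e) :
    ((σ.t : ℝ) - 1) * (γ ^ 4 * (1 - γ ^ 2) * e ^ 2) ≤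
      γ ^ 2 * (2 * omegaDiam Y ω ^ 2 * L ^ 2) := by
  rcases hσ.phase with ⟨ht, -⟩ | ⟨Δ, hΔ⟩
  · rw [ht, Nat.cast_one, sub_self, zero_mul]
    positivity
  · have ht : 0 ≤ (σ.t : ℝ) - 1 := sub_nonneg.2 (Nat.one_le_cast.2 hσ.consistent.one_le_t)
    have hpos := H.one_sub_sq_pos
    have hgap : e ≤ γ * Δ := (startsPhase_iff hΔ.gap_eq).1 hs
    calc ((σ.t : ℝ) - 1) * (γ ^ 4 * (1 - γ ^ 2) * e ^ 2)
        ≤ ((σ.t : ℝ) - 1) * (γ ^ 4 * (1 - γ ^ 2) * (γ * Δ) ^ 2) := by gcongr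
      _ = γ ^ 2 * (((σ.t : ℝ) - 1) * (γ ^ 4 * (1 - γ ^ 2) * Δ ^ 2)) := by ring
      _ ≤ γ ^ 2 * (2 * omegaDiam Y ω ^ 2 * L ^ 2) :=
        mul_le_mul_of_nonneg_left (hΔ.steps_mul_le H hσ.consistent) (sq_nonneg γ)

theorem Step.inPhase_of_startsPhase (H : StandingAssumptions Y ν ω ω' g L γ ε yω)
    (hσ : Invariant Y ω ω' g L γ ε yω σ) (h : Step Y ω ω' g γ ε yω σ e lam σ')
    (hs : StartsPhase γ σ e) : InPhase Y ω ω' g L γ ε σ' e where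
  gap_eq := by rw [h.gap_eq, newGap, if_pos hs]
  lt_gap := h.not_done
  exists_common := by
    obtain ⟨u, hu, hslater⟩ :=
      hσ.consistent.slater h.solves H.γ_lt_one (H.ε_pos.trans h.not_done)
    exact ⟨u, hu, (h.forall_mem_I_iff hσ.consistent (γ * e ≤ affineAt g · u)).2 fun τ hτ =>
      (lt_affineAt_iff.2 (hslater τ hτ)).le⟩
  exists_le z hz := by
    obtain ⟨τ, hτ, hpos, hle⟩ := h.solves.exists_ge hz
    refine (h.exists_mem_I_iff hσ.consistent (affineAt g · z ≤ e)).2 ⟨τ, ?_, hle⟩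
    rw [newI, if_pos hs]
    exact Finset.mem_union_left _ (Finset.mem_filter.2 ⟨hσ.consistent.subset hτ, hpos⟩)
  potential_le u hu hlevel := by
    have he : 0 < e := H.ε_pos.trans h.not_done
    have hearlier := hσ.steps_mul_le_of_startsPhase H hs he.le
    have hdecr := h.bregman_add_le H hσ.consistent
      ⟨hu, (h.forall_mem_I_iff hσ.consistent (γ * e ≤ affineAt g · u)).1 hlevel⟩
    rw [proxCenter, if_pos hs] at hdecr
    have hstart := hdecr.trans (H.bregman_center_le hu)
    have hγe : γ ^ 4 * e ^ 2 ≤ γ ^ 2 * e ^ 2 :=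
      mul_le_mul_of_nonneg_right
        (pow_le_pow_of_le_one H.γ_pos.le H.γ_lt_one.le (by norm_num)) (sq_nonneg e)
    have hscaled := mul_le_mul_of_nonneg_left (add_le_add hstart hγe) H.one_sub_sq_pos.le
    have ht : (σ'.t : ℝ) = σ.t + 1 := by rw [h.t_eq, Nat.cast_succ]
    rw [ht]
    linarith

theorem Step.inPhase_of_not_startsPhase (H : StandingAssumptions Y ν ω ω' g L γ ε yω)
    (hσ : IsConsistent Y ω yω σ) {Δ : ℝ} (hΔ : InPhase Y ω ω' g L γ ε σ Δ)
    (h : Step Y ω ω' g γ ε yω σ e lam σ') (hs : ¬ StartsPhase γ σ e) :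
    InPhase Y ω ω' g L γ ε σ' Δ := by
  have hI : σ.I ⊆ newI γ σ e lam := by
    rw [newI, if_neg hs]
    exact Finset.subset_insert _ _
  have hgt : γ * Δ < e := not_le.1 ((startsPhase_iff hΔ.gap_eq).not.1 hs)
  obtain ⟨w, hw, hmax⟩ := h.solves.exists_le
  have hle : e ≤ Δ := by
    obtain ⟨τ, hτ, hτΔ⟩ := hΔ.exists_le w hw
    exact (hmax τ (Finset.mem_insert_of_mem hτ)).trans hτΔ
  refine ⟨by rw [h.gap_eq, newGap, if_neg hs, hΔ.gap_eq], hΔ.lt_gap, ⟨w, hw, ?_⟩,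
    fun z hz => ?_, fun u hu hlevel => ?_⟩
  · exact (h.forall_mem_I_iff hσ (γ * Δ ≤ affineAt g · w)).2 fun τ hτ =>
      hgt.le.trans (hmax τ (hσ.newI_subset h.solves hτ))
  · obtain ⟨τ, hτ, hτΔ⟩ := hΔ.exists_le z hz
    exact (h.exists_mem_I_iff hσ (affineAt g · z ≤ Δ)).2 ⟨τ, hI hτ, hτΔ⟩
  · rw [h.forall_mem_I_iff hσ (γ * Δ ≤ affineAt g · u)] at hlevel
    have hdecr := h.bregman_add_le H hσ
      ⟨hu, fun τ hτ => (mul_le_mul_of_nonneg_left hle H.γ_pos.le).trans (hlevel τ hτ)⟩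
    rw [proxCenter, if_neg hs] at hdecr
    have hpotential := hΔ.potential_le u hu fun τ hτ => hlevel τ (hI hτ)
    have hγΔ : γ ^ 2 * (γ * Δ) ^ 2 ≤ γ ^ 2 * e ^ 2 := by
      have := mul_pos H.γ_pos (H.ε_pos.trans hΔ.lt_gap)
      gcongr
    have hscaled := mul_le_mul_of_nonneg_left (add_le_add hdecr hγΔ) H.one_sub_sq_pos.le
    have ht : (σ'.t : ℝ) = σ.t + 1 := by rw [h.t_eq, Nat.cast_succ]
    rw [ht]
    linarith

theorem Step.invariant (H : StandingAssumptions Y ν ω ω' g L γ ε yω)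
    (hσ : Invariant Y ω ω' g L γ ε yω σ) (h : Step Y ω ω' g γ ε yω σ e lam σ') :
    Invariant Y ω ω' g L γ ε yω σ' := by
  refine ⟨h.isConsistent H hσ.consistent, Or.inr ?_⟩
  by_cases hs : StartsPhase γ σ e
  · exact ⟨e, h.inPhase_of_startsPhase H hσ hs⟩
  · rcases hσ.phase with ⟨-, htop⟩ | ⟨Δ, hΔ⟩
    · exact absurd (startsPhase_of_gap_eq_top H.γ_pos htop) hs
    · exact ⟨Δ, h.inPhase_of_not_startsPhase H hσ.consistent hΔ hs⟩

theorem StandingAssumptions.invariant (H : StandingAssumptions Y ν ω ω' g L γ ε yω)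
    (hr : Reachable Y ω ω' g γ ε yω σ) : Invariant Y ω ω' g L γ ε yω σ := by
  induction hr with
  | init => exact ⟨isConsistent_initState H.center, Or.inl ⟨rfl, rfl⟩⟩
  | step _ hstep ih => exact hstep.invariant H ih

theorem StandingAssumptions.t_le (H : StandingAssumptions Y ν ω ω' g L γ ε yω)
    (hr : Reachable Y ω ω' g γ ε yω σ) :
    (σ.t : ℝ) ≤ 2 * omegaDiam Y ω ^ 2 * L ^ 2 / (γ ^ 4 * (1 - γ ^ 2) * ε ^ 2) + 1 := by
  have hσ := H.invariant hr
  have hγ := H.γ_pos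
  have hε := H.ε_pos
  have hpos := H.one_sub_sq_pos
  rw [← sub_le_iff_le_add, le_div_iff₀ (by positivity)]
  rcases hσ.phase with ⟨ht, -⟩ | ⟨Δ, hΔ⟩
  · rw [ht, Nat.cast_one, sub_self, zero_mul]
    positivity
  · refine le_trans ?_ (hΔ.steps_mul_le H hσ.consistent)
    have ht : 0 ≤ (σ.t : ℝ) - 1 := sub_nonneg.2 (Nat.one_le_cast.2 hσ.consistent.one_le_t)
    have hgap := hΔ.lt_gap.le
    gcongr

theorem StandingAssumptions.not_forall_exists_reachable
    (H : StandingAssumptions Y ν ω ω' g L γ ε yω) :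
    ¬ ∀ n : ℕ, ∃ σ, Reachable Y ω ω' g γ ε yω σ ∧ σ.t = n + 1 := by
  intro hall
  obtain ⟨n, hn⟩ := exists_nat_gt
    (2 * omegaDiam Y ω ^ 2 * L ^ 2 / (γ ^ 4 * (1 - γ ^ 2) * ε ^ 2))
  obtain ⟨σ, hσ, ht⟩ := hall n
  have hle := H.t_le hσ
  rw [ht, Nat.cast_succ] at hle
  linarith

theorem StandingAssumptions.not_exists_infinite_run
    (H : StandingAssumptions Y ν ω ω' g L γ ε yω) :
    ¬ ∃ σ : ℕ → State E, σ 0 = initState yω ∧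
      ∀ n, ∃ e lam, Step Y ω ω' g γ ε yω (σ n) e lam (σ (n + 1)) := by
  rintro ⟨σ, hinit, hstep⟩
  refine H.not_forall_exists_reachable fun n => ⟨σ n, ?_⟩
  induction n with
  | zero => exact hinit ▸ ⟨.init, rfl⟩
  | succ n ih =>
    obtain ⟨e, lam, hn⟩ := hstep n
    exact ⟨.step ih.1 hn, by rw [hn.t_eq, ih.2]⟩

theorem StandingAssumptions.exists_terminatesAt (H : StandingAssumptions Y ν ω ω' g L γ ε yω) :
    ∃ σ lam, TerminatesAt Y ω ω' g γ ε yω σ lam := by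
  by_contra! hterm
  refine H.not_forall_exists_reachable fun n => ?_
  induction n with
  | zero => exact ⟨_, .init, rfl⟩
  | succ n ih =>
    obtain ⟨σ, hσ, ht⟩ := ih
    obtain ⟨e, lam, hsol⟩ :=
      exists_solvesAux H.isCompact ⟨yω, H.center.1⟩ H.setup.convexOn.1 g σ
    have he : ε < e := not_le.1 fun hle => hterm σ lam ⟨hσ, e, hsol, hle⟩
    obtain ⟨σ', hstep, -⟩ := H.existsUnique_step (H.invariant hσ).consistent hsol he
    exact ⟨σ', .step hσ hstep, by rw [hstep.t_eq, ht]⟩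

theorem TerminatesAt.isGreatest_resolution_and_le (h : TerminatesAt Y ω ω' g γ ε yω σ lam)
    (hσ : IsConsistent Y ω yω σ) :
    IsGreatest (certificateValues Y g σ.t σ.y lam) (resolution Y g σ.t σ.y lam) ∧
      resolution Y g σ.t σ.y lam ≤ ε := by
  obtain ⟨-, e, hsol, hle⟩ := h
  have hgreatest := hsol.isGreatest_certificateValues hσ.subset
  rw [resolution, hgreatest.csSup_eq]
  exact ⟨hgreatest, hle⟩

end Method

end MDL

theorem proposition5_general {E : Type*} [NormedAddCommGroup E] [InnerProductSpace ℝ E]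
    (Y : Set E) (hY : IsCompact Y) (hYne : Y.Nonempty) (ν : Seminorm ℝ E) (ω : E → ℝ) (ω' : E → E)
    (hω : MDL.IsProximalSetup Y ν ω ω') (hν : Continuous ν) (g : E → E) (L : ℝ)
    (hg : ∀ y ∈ Y, ∀ x, inner ℝ (g y) x ≤ L * ν x)
    (γ : ℝ) (hγ : γ ∈ Set.Ioo (0 : ℝ) 1) (ε : ℝ) (hε : 0 < ε) :
    (∃! yω, MDL.IsArgmin Y ω yω) ∧
    ∀ yω, MDL.IsArgmin Y ω yω →
      (∀ σ, MDL.Reachable Y ω ω' g γ ε yω σ →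
        (∃ e lam, MDL.SolvesAux Y g σ e lam) ∧
        ∀ e lam, MDL.SolvesAux Y g σ e lam → ε < e →
          ∃! σ', MDL.Step Y ω ω' g γ ε yω σ e lam σ') ∧
      (∀ σ, MDL.Reachable Y ω ω' g γ ε yω σ →
        (σ.t : ℝ) ≤
          2 * MDL.omegaDiam Y ω ^ 2 * L ^ 2 / (γ ^ 4 * (1 - γ ^ 2) * ε ^ 2) + 1) ∧
      (¬ ∃ σ : ℕ → MDL.State E, σ 0 = MDL.initState yω ∧
        ∀ n, ∃ e lam, MDL.Step Y ω ω' g γ ε yω (σ n) e lam (σ (n + 1))) ∧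
      (∃ σ lam, MDL.TerminatesAt Y ω ω' g γ ε yω σ lam) ∧
      (∀ σ lam, MDL.TerminatesAt Y ω ω' g γ ε yω σ lam →
        (∀ τ ∈ Finset.Icc 1 σ.t, σ.y τ ∈ Y) ∧
        MDL.IsCertificate σ.t lam ∧
        IsGreatest (MDL.certificateValues Y g σ.t σ.y lam)
          (MDL.resolution Y g σ.t σ.y lam) ∧
        MDL.resolution Y g σ.t σ.y lam ≤ ε) := by
  refine ⟨?_, fun yω hyω => ?_⟩
  · obtain ⟨x, hx⟩ := MDL.exists_isArgmin hY hYne hω.continuousOn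
    exact ⟨x, hx, fun z hz => hω.argmin_unique hY hν hx hz⟩
  have H : MDL.StandingAssumptions Y ν ω ω' g L γ ε yω := ⟨hY, hω, hν, hg, hγ.1, hγ.2, hε, hyω⟩
  refine ⟨fun σ hσ => ⟨MDL.exists_solvesAux hY hYne hω.convexOn.1 g σ, fun e lam hsol he => ?_⟩,
    fun σ hσ => H.t_le hσ, H.not_exists_infinite_run, H.exists_terminatesAt, fun σ lam hterm => ?_⟩
  · exact H.existsUnique_step (H.invariant hσ).consistent hsol he
  · have hσ := (H.invariant hterm.1).consistent
    obtain ⟨e, hsol, -⟩ := hterm.2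
    exact ⟨fun τ hτ => (hσ.mem_domain τ hτ).1, hsol.isCertificate hσ.subset,
      hterm.isGreatest_resolution_and_le hσ⟩

theorem proposition5 {E : Type*} [NormedAddCommGroup E] [InnerProductSpace ℝ E]
    [FiniteDimensional ℝ E] (Y : Set E) (hY : IsCompact Y) (hYne : Y.Nonempty)
    (hYconv : Convex ℝ Y)
    (ν : Seminorm ℝ E) (ω : E → ℝ) (ω' : E → E) (hω : MDL.IsProximalSetup Y ν ω ω')
    (g : E → E) (L : ℝ) (hg : ∀ y ∈ Y, MDL.dualNorm ν (g y) ≤ L)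
    (γ : ℝ) (hγ : γ ∈ Set.Ioo (0 : ℝ) 1) (ε : ℝ) (hε : 0 < ε) :
    -- the `ω`-center is well defined
    (∃! yω, MDL.IsArgmin Y ω yω) ∧
    ∀ yω, MDL.IsArgmin Y ω yω →
      -- every step that is entered can be carried out: the auxiliary problem has a solution, and
      -- unless its value is at most `ε`, the next search point exists and is unique
      (∀ σ, MDL.Reachable Y ω ω' g γ ε yω σ →
        (∃ e lam, MDL.SolvesAux Y g σ e lam) ∧
        ∀ e lam, MDL.SolvesAux Y g σ e lam → ε < e →
          ∃! σ', MDL.Step Y ω ω' g γ ε yω σ e lam σ') ∧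
      -- the number of steps obeys the bound
      (∀ σ, MDL.Reachable Y ω ω' g γ ε yω σ →
        (σ.t : ℝ) ≤
          2 * MDL.omegaDiam Y ω ^ 2 * L ^ 2 / (γ ^ 4 * (1 - γ ^ 2) * ε ^ 2) + 1) ∧
      -- there is no infinite run, and there is a run that terminates
      (¬ ∃ σ : ℕ → MDL.State E, σ 0 = MDL.initState yω ∧
        ∀ n, ∃ e lam, MDL.Step Y ω ω' g γ ε yω (σ n) e lam (σ (n + 1))) ∧
      (∃ σ lam, MDL.TerminatesAt Y ω ω' g γ ε yω σ lam) ∧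
      -- every output is an execution protocol with a certificate of resolution at most `ε`
      (∀ σ lam, MDL.TerminatesAt Y ω ω' g γ ε yω σ lam →
        (∀ τ ∈ Finset.Icc 1 σ.t, σ.y τ ∈ Y) ∧
        MDL.IsCertificate σ.t lam ∧
        IsGreatest (MDL.certificateValues Y g σ.t σ.y lam)
          (MDL.resolution Y g σ.t σ.y lam) ∧
        MDL.resolution Y g σ.t σ.y lam ≤ ε) :=
  proposition5_general Y hY hYne ν ω ω' hω (MDL.continuous_seminorm ν) g L
    (fun y hy x => (MDL.inner_le_dualNorm_mul hω.norm_definite _ x).trans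
      (mul_le_mul_of_nonneg_right (hg y hy) (apply_nonneg ν x))) γ hγ ε hε
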